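/- Let $G_\sigma=(G,\sigma)$ be a connected signed simple graph with vertices $t_1,\dots,t_s$, $s\ge 2$, edges $e_1,\dots,e_m$ and signs $\sigma\colon E(G)\to\{+,-\}$, and let $K$ be a finite field. The incidence matrix $A$ of $G_\sigma$ over $K$ is the $s\times m$ matrix whose column at an edge $e=\{t_i,t_j\}$ is $\mathbf e_i-\mathbf e_j$ (with either choice of the order of $i,j$) if $\sigma(e)=+$ and $\mathbf e_i+\mathbf e_j$ if $\sigma(e)=-$. Let $C\subset K^m$ be the incidence matrix code of $G_\sigma$, that is, the linear code generated by the rows of $A$, and let $\delta(C)$ be its minimum distance, the minimum number of nonzero entries of a nonzero vector of $C$. Let $\mathbb X\subset\mathbb P^{s-1}$ be the set of projective points defined by the columns of $A$, let $S=K[t_1,\dots,t_s]=\bigoplus_{d\ge 0}S_d$ with the standard grading, and let $I(\mathbb X)\subset S$ be the ideal generated by the homogeneous polynomials vanishing at all points of $\mathbb X$. For a graded ideal $J\subset S$ such that $S/J$ has Krull dimension $k$, let $$\deg(S/J)=(k-1)!\lim_{d\to\infty}\frac{\dim_K(S_d/(J\cap S_d))}{d^{k-1}}\quad(k\ge 1),\qquad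 \deg(S/J)=\dim_K(S/J)\quad(k=0),$$ and for $h\in S$ let $(J\colon h)=\{g\in S : gh\in J\}$. Then $C\neq 0$ and $$\delta(C)=|\mathbb X|-\max\{\deg(S/(I(\mathbb X),h)) : h\in S_1\setminus I(\mathbb X),\ (I(\mathbb X)\colon h)\neq I(\mathbb X)\}.$$ If $s\ge 3$, the set on the right is nonempty and the maximum is attained. If $s=2$ (a single edge), the set is empty, its maximum is read as $0$, and $\delta(C)=|\mathbb X|$. -/

import Mathlib

open MvPolynomial Filter
open scoped LinearAlgebra.Projectivization

noncomputable section

namespace SignedGraphCode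

/-! ### Signed simple graphs and their incidence matrix codes -/

section Codes

variable {V : Type*} (G : SimpleGraph V)

/-- An ordering of the two endpoints of every edge of `G`. It fixes the sign of the columns
`e_i - e_j` of the incidence matrix, which are only defined up to sign. -/
abbrev EdgeOrdering : Type _ :=
  ∀ e : G.edgeSet, {p : V × V // s(p.1, p.2) = (e : Sym2 V)}

variable {G}

/-- The incidence matrix over `K` of the signed simple graph `(G, σ)`, where `σ e = 1` is the
sign `+` and `σ e = -1` is the sign `-`. If `e = {i, j}`, the column of `e` is `e_i - e_j` if
`σ e = +` and `e_i + e_j` if `σ e = -`. -/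
def incidenceMatrix [DecidableEq V] (K : Type*) [Field K] (σ : G.edgeSet → ℤˣ)
    (o : EdgeOrdering G) : Matrix V G.edgeSet K :=
  Matrix.of fun v e =>
    (Pi.single (o e).1.1 1 - (((σ e : ℤˣ) : ℤ) : K) • Pi.single (o e).1.2 1 : V → K) v

/-- The linear code generated by the rows of a matrix. -/
def rowCode {V E K : Type*} [Field K] (A : Matrix V E K) : Submodule K (E → K) :=
  Submodule.span K (Set.range fun v => A.row v)

/-- The minimum distance of a linear code: the minimum Hamming weight of its nonzero words. -/
def minDist {E K : Type*} [Fintype E] [Field K] [DecidableEq K] (C : Submodule K (E → K)) : ℕ :=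
  sInf {w | ∃ x ∈ C, x ≠ 0 ∧ hammingNorm x = w}

/-- The set of projective points defined by the (nonzero) columns of a matrix. -/
def columnPoints {V E K : Type*} [Field K] (A : Matrix V E K) : Set (ℙ K (V → K)) :=
  {P | ∃ (e : E) (he : A.col e ≠ 0), P = Projectivization.mk K (A.col e) he}

end Codes

/-! ### Vanishing ideals and the degree of a graded ideal -/

section Ideals

variable {V K : Type*} [Field K]

/-- The vanishing ideal of a set of projective points: the ideal generated by the homogeneous
polynomials that vanish at all its points. (Vanishing of a homogeneous polynomial does not
depend on the representative of the point.) -/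
def vanishingIdeal (X : Set (ℙ K (V → K))) : Ideal (MvPolynomial V K) :=
  Ideal.span {f | (∃ d : ℕ, f.IsHomogeneous d) ∧ ∀ P ∈ X, eval P.rep f = 0}

/-- The Hilbert function `d ↦ dim_K (S_d / J_d)` of `S / J`, where `J_d = J ∩ S_d`. -/
def hilbertFunction (J : Ideal (MvPolynomial V K)) (d : ℕ) : ℕ :=
  Module.finrank K
    (homogeneousSubmodule V K d ⧸
      (J.restrictScalars K).comap (homogeneousSubmodule V K d).subtype)

/-- The Krull dimension of `S / J` as a natural number (`0` if `J` is the unit ideal). -/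
def krullDimension (J : Ideal (MvPolynomial V K)) : ℕ :=
  ((ringKrullDim (MvPolynomial V K ⧸ J)).unbotD 0).toNat

/-- The degree (multiplicity) of `S / J`, with `k` the Krull dimension of `S / J`:
`(k-1)! * lim_{d → ∞} H_J(d) / d^(k-1)` if `k ≥ 1`, and `dim_K (S / J)` if `k = 0`. -/
def degree (J : Ideal (MvPolynomial V K)) : ℝ :=
  if krullDimension J = 0 then (Module.finrank K (MvPolynomial V K ⧸ J) : ℝ)
  else ((krullDimension J - 1).factorial : ℝ) *
    limUnder atTop (fun d : ℕ => (hilbertFunction J d : ℝ) / (d : ℝ) ^ (krullDimension J - 1))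

/-- The values `deg (S / (I, h))` for linear forms `h ∈ S_1 \ I` with `(I : h) ≠ I`. -/
def linearSectionDegrees (I : Ideal (MvPolynomial V K)) : Set ℝ :=
  {M | ∃ h : MvPolynomial V K, h.IsHomogeneous 1 ∧ h ∉ I ∧ Submodule.colon I {h} ≠ I ∧
    M = degree (I ⊔ Ideal.span {h})}

end Ideals

end SignedGraphCode

end

/-! Codewords are the value vectors of linear forms `h` at the columns of `A`. A column is supported
on the two ends of its edge, so distinct edges give distinct projective points
(`mk_col_incidenceMatrix_injective`), and the weight of a word is `|X|` minus the number of zeros of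
`h` on `X`.

On the algebraic side, `h ∉ I(X)` says that the word is nonzero, and `(I(X) : h) ≠ I(X)` that `h`
has a zero on `X` (`colon_vanishingIdeal_ne_iff`). In that case `S/(I(X), h)` has dimension one, and
interpolation shows that its Hilbert function is eventually the number of these zeros
(`hilbertFunction_linearSection`). So maximal degree means minimal weight, provided some nonzero
word has a zero entry. For `s ≥ 3` a variable off some edge gives such a word; for `s = 2` there is
only one point. -/

namespace SignedGraphCode

/-! ### Krull dimension of quotients -/

/-- If `J` contains a finite intersection of kernels of surjections onto rings in which every
nonzero prime is maximal, then `R ⧸ J` has Krull dimension at most one. -/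
lemma krullDimLE_one_quotient {R A ι : Type*} [CommRing R] [CommRing A] [IsDomain A]
    [Ring.KrullDimLE 1 A] (s : Finset ι) (φ : ι → R →+* A)
    (hφ : ∀ i ∈ s, Function.Surjective (φ i)) {J : Ideal R}
    (hJ : s.inf (fun i => RingHom.ker (φ i)) ≤ J) : Ring.KrullDimLE 1 (R ⧸ J) := by
  refine Ring.KrullDimLE.mk₁ fun I hI => or_iff_not_imp_right.2 fun hmax => ?_
  refine ⟨⟨hI, bot_le⟩, fun q hq hqI => ?_⟩
  have hsurj : Function.Surjective (Ideal.Quotient.mk J) := Ideal.Quotient.mk_surjective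
  by_contra hle
  have hqp : (q.comap (Ideal.Quotient.mk J)).IsPrime := hq.1.comap _
  have hIp : (I.comap (Ideal.Quotient.mk J)).IsPrime := hI.comap _
  have hJq : J ≤ q.comap (Ideal.Quotient.mk J) := fun x hx => by
    simp [Ideal.mem_comap, Ideal.Quotient.eq_zero_iff_mem.2 hx]
  -- A prime containing a finite intersection contains one of the kernels, so the chain `q < I`
  -- descends to `A`, where the nonzero prime image of `I` is maximal.
  obtain ⟨i, hi, hker⟩ := hqp.inf_le'.1 (hJ.trans hJq)
  have hkerI := hker.trans (Ideal.comap_mono (f := Ideal.Quotient.mk J) hqI)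
  have hmp : ((I.comap (Ideal.Quotient.mk J)).map (φ i)).IsPrime :=
    Ideal.map_isPrime_of_surjective (hφ i hi) hkerI
  have hne : (I.comap (Ideal.Quotient.mk J)).map (φ i) ≠ ⊥ := fun h => by
    rw [Ideal.map_eq_bot_iff_le_ker] at h
    exact hle ((Ideal.comap_le_comap_iff_of_surjective _ hsurj I q).1 (h.trans hker))
  have hm := hmp.isMaximal_of_ne_bot hne
  have hm' := Ideal.comap_isMaximal_of_surjective (φ i) (hφ i hi) (H := hm)
  rw [Ideal.comap_map_of_surjective' _ (hφ i hi), sup_eq_left.2 hkerI] at hm'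
  have hm2 := Ideal.IsMaximal.map_of_surjective_of_ker_le hsurj
    (by simpa [Ideal.mk_ker] using hJq.trans (Ideal.comap_mono hqI))
    (m := I.comap (Ideal.Quotient.mk J))
  rw [Ideal.map_comap_of_surjective _ hsurj] at hm2
  exact hmax hm2

/-! ### Finite sets of projective points: vanishing ideals, interpolation, linear sections -/

section Points

variable {V K : Type*} [Field K]

/-- Restriction of polynomials to the line spanned by `v`. -/
noncomputable def lineRestriction (v : V → K) : MvPolynomial V K →ₐ[K] Polynomial K :=
  aeval fun i => Polynomial.C (v i) * Polynomial.X

lemma lineRestriction_of_isHomogeneous (v : V → K) {f : MvPolynomial V K} {d : ℕ}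
    (hf : f.IsHomogeneous d) :
    lineRestriction v f = Polynomial.C (eval v f) * Polynomial.X ^ d := by
  rw [lineRestriction, aeval_def, eval₂_eq, eval_eq, map_sum, Finset.sum_mul]
  refine Finset.sum_congr rfl fun m hm => ?_
  have hd : m.degree = d := by
    rw [Finsupp.degree_eq_weight_one]
    exact hf (mem_support_iff.1 hm)
  have : ∏ i ∈ m.support, (Polynomial.X : Polynomial K) ^ m i = Polynomial.X ^ d := by
    rw [Finset.prod_pow_eq_pow_sum, ← hd, Finsupp.degree_apply]
  simp only [mul_pow, Finset.prod_mul_distrib, this, map_mul, map_prod, map_pow,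
    Polynomial.algebraMap_eq, mul_assoc]

lemma lineRestriction_eq_zero_iff (v : V → K) (f : MvPolynomial V K) :
    lineRestriction v f = 0 ↔ ∀ d, eval v (homogeneousComponent d f) = 0 := by
  have key : ∀ d, (lineRestriction v f).coeff d = eval v (homogeneousComponent d f) := by
    intro d
    conv_lhs => rw [← sum_homogeneousComponent f]
    simp only [map_sum, lineRestriction_of_isHomogeneous v (homogeneousComponent_isHomogeneous _ f),
      Polynomial.finsetSum_coeff, Polynomial.coeff_C_mul, Polynomial.coeff_X_pow]
    simp only [mul_ite, mul_one, mul_zero, Finset.sum_ite_eq, Finset.mem_range]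
    split_ifs with h
    · rfl
    · rw [homogeneousComponent_eq_zero _ _ (by omega), map_zero]
  simp [Polynomial.ext_iff, key]

lemma lineRestriction_surjective {v : V → K} (hv : v ≠ 0) :
    Function.Surjective (lineRestriction v) := by
  obtain ⟨i, hi⟩ := Function.ne_iff.1 hv
  have hi : v i ≠ 0 := hi
  rw [← AlgHom.range_eq_top, eq_top_iff, ← Polynomial.adjoin_X, Algebra.adjoin_le_iff]
  rintro _ rfl
  refine ⟨C (v i)⁻¹ * X i, ?_⟩
  change aeval _ _ = _
  rw [map_mul, aeval_X, aeval_C, Polynomial.algebraMap_eq, ← mul_assoc, ← map_mul,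
    inv_mul_cancel₀ hi, map_one, one_mul]

/-- Restriction to a line keeps the values of the homogeneous components apart as coefficients. This
presents the ideal as an intersection of kernels of maps onto `K[X]`, even over a finite field. -/
lemma mem_vanishingIdeal_iff {X : Set (ℙ K (V → K))} {f : MvPolynomial V K} :
    f ∈ vanishingIdeal X ↔ ∀ P ∈ X, lineRestriction P.rep f = 0 := by
  constructor
  · intro hf P hP
    have : vanishingIdeal X ≤ RingHom.ker (lineRestriction P.rep) := by
      refine Ideal.span_le.2 ?_
      rintro g ⟨⟨d, hd⟩, hg⟩
      simp [RingHom.mem_ker, lineRestriction_of_isHomogeneous _ hd, hg P hP]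
    exact this hf
  · intro h
    rw [← sum_homogeneousComponent f]
    refine Ideal.sum_mem _ fun d _ => Ideal.subset_span
      ⟨⟨d, homogeneousComponent_isHomogeneous d f⟩, fun P hP => ?_⟩
    exact (lineRestriction_eq_zero_iff _ _).1 (h P hP) d

lemma mem_vanishingIdeal_iff_of_isHomogeneous {X : Set (ℙ K (V → K))} {f : MvPolynomial V K}
    {d : ℕ} (hf : f.IsHomogeneous d) :
    f ∈ vanishingIdeal X ↔ ∀ P ∈ X, eval P.rep f = 0 := by
  simp [mem_vanishingIdeal_iff, lineRestriction_of_isHomogeneous _ hf]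

/-- A linear form separating two distinct projective points. -/
lemma exists_linearForm_separating {P Q : ℙ K (V → K)} (h : P ≠ Q) :
    ∃ f : MvPolynomial V K, f.IsHomogeneous 1 ∧ eval Q.rep f = 0 ∧ eval P.rep f ≠ 0 := by
  obtain ⟨i, hi⟩ := Function.ne_iff.1 Q.rep_nonzero
  have hi : Q.rep i ≠ 0 := hi
  by_contra! hcon
  refine h ?_
  rw [← P.mk_rep, ← Q.mk_rep, Projectivization.mk_eq_mk_iff']
  refine ⟨P.rep i / Q.rep i, ?_⟩
  ext j
  -- This form vanishes at `Q`; if it vanishes at `P` for every `j`, then `P` is proportional to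
  -- `Q`.
  have := hcon (C (Q.rep i) * X j - C (Q.rep j) * X i)
    (((isHomogeneous_C_mul_X _ _)).sub (isHomogeneous_C_mul_X _ _)) (by simp [mul_comm])
  simp only [map_sub, map_mul, eval_C, eval_X] at this
  simp only [Pi.smul_apply, smul_eq_mul]
  field_simp
  linear_combination -this

/-- Multiply linear forms that separate `P` from each point of `s`, pad with a power of a coordinate
nonzero at `P`, and normalize. -/
lemma exists_isHomogeneous_eval_eq_one_of_finset (s : Finset (ℙ K (V → K))) {P : ℙ K (V → K)}
    (hP : P ∉ s) {d : ℕ} (hd : s.card ≤ d) :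
    ∃ f : MvPolynomial V K, f.IsHomogeneous d ∧ eval P.rep f = 1 ∧
      ∀ Q ∈ s, eval Q.rep f = 0 := by
  have hne : ∀ Q ∈ s, P ≠ Q := fun Q hQ h => hP (h ▸ hQ)
  choose! l hl1 hl0 hlP using fun Q hQ => exists_linearForm_separating (hne Q hQ)
  obtain ⟨i, hi⟩ := Function.ne_iff.1 P.rep_nonzero
  have hi : P.rep i ≠ 0 := hi
  set g := (∏ Q ∈ s, l Q) * X i ^ (d - s.card) with hg
  have hgh : g.IsHomogeneous d := by
    have h1 := IsHomogeneous.prod s l (fun _ => 1) hl1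
    have h2 := (isHomogeneous_X K i).pow (d - s.card)
    convert h1.mul h2 using 1
    simp only [Finset.sum_const, smul_eq_mul]
    omega
  have hgP : eval P.rep g ≠ 0 := by
    rw [hg, map_mul, map_prod, map_pow, eval_X]
    exact mul_ne_zero (Finset.prod_ne_zero_iff.2 hlP) (pow_ne_zero _ hi)
  refine ⟨C (eval P.rep g)⁻¹ * g, hgh.C_mul _, by simp [hgP], fun Q hQ => ?_⟩
  have hgQ : eval Q.rep g = 0 := by
    rw [hg, map_mul, map_prod, Finset.prod_eq_zero hQ (hl0 Q hQ), zero_mul]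
  rw [map_mul, hgQ, mul_zero]

/-- Interpolation on finitely many projective points by forms of large degree. -/
lemma exists_isHomogeneous_eval_eq (s : Finset (ℙ K (V → K))) (a : ℙ K (V → K) → K) {d : ℕ}
    (hd : s.card ≤ d + 1) :
    ∃ f : MvPolynomial V K, f.IsHomogeneous d ∧ ∀ P ∈ s, eval P.rep f = a P := by
  classical
  have h : ∀ P ∈ s, ∃ f : MvPolynomial V K, f.IsHomogeneous d ∧ eval P.rep f = 1 ∧
      ∀ Q ∈ s.erase P, eval Q.rep f = 0 := fun P hP =>
    exists_isHomogeneous_eval_eq_one_of_finset _ (Finset.notMem_erase P s)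
      (by rw [Finset.card_erase_of_mem hP]; omega)
  choose! f hf h1 h0 using h
  refine ⟨∑ P ∈ s, C (a P) * f P, IsHomogeneous.sum _ _ _ fun P hP => (hf P hP).C_mul _,
    fun P hP => ?_⟩
  rw [map_sum, Finset.sum_eq_single P]
  · simp [h1 P hP]
  · intro Q hQ hQP
    simp [h0 Q hQ P (Finset.mem_erase.2 ⟨hQP.symm, hP⟩)]
  · exact fun h => (h hP).elim

variable {X : Set (ℙ K (V → K))} {h : MvPolynomial V K}

/-- If `h` has no zero on `X`, it restricts to a nonzero element of the domain `K[X]` on each line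
and can be cancelled. At a zero `P`, a form that is the indicator of `P` on `X` lies in the colon
ideal but not in the ideal. -/
lemma colon_vanishingIdeal_ne_iff (hX : X.Finite) (hh : h.IsHomogeneous 1) :
    Submodule.colon (vanishingIdeal X) {h} ≠ vanishingIdeal X ↔
      {P ∈ X | eval P.rep h = 0}.Nonempty := by
  constructor
  · rintro hne
    by_contra hemp
    refine hne (le_antisymm (fun g hg => ?_) fun g hg => ?_)
    · rw [Submodule.mem_colon_singleton, smul_eq_mul, mem_vanishingIdeal_iff] at hg
      rw [mem_vanishingIdeal_iff]
      intro P hP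
      have := hg P hP
      rw [map_mul, mul_eq_zero] at this
      refine this.resolve_right fun h0 => hemp ⟨P, hP, ?_⟩
      simpa [lineRestriction_of_isHomogeneous _ hh] using h0
    · exact Submodule.mem_colon_singleton.2 (Ideal.mul_mem_right _ _ hg)
  · rintro ⟨P, hP, hPh⟩ heq
    classical
    obtain ⟨g, hg, hgP⟩ := exists_isHomogeneous_eval_eq hX.toFinset
      (fun Q => if Q = P then 1 else 0) (Nat.le_succ _)
    have hgI : g ∉ vanishingIdeal X := fun hmem => by
      have h0 := (mem_vanishingIdeal_iff_of_isHomogeneous hg).1 hmem P hP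
      rw [hgP P (by simpa using hP)] at h0
      simp at h0
    refine hgI (heq ▸ Submodule.mem_colon_singleton.2 ?_)
    rw [smul_eq_mul, mem_vanishingIdeal_iff_of_isHomogeneous (hg.mul hh)]
    intro Q hQ
    rw [map_mul, hgP Q (by simpa using hQ)]
    split_ifs with hQP
    · rw [hQP, hPh, mul_zero]
    · rw [zero_mul]

lemma sup_span_le_ker_lineRestriction (hh : h.IsHomogeneous 1) {P : ℙ K (V → K)} (hP : P ∈ X)
    (hPh : eval P.rep h = 0) :
    vanishingIdeal X ⊔ Ideal.span {h} ≤ RingHom.ker (lineRestriction P.rep) := by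
  refine sup_le (fun f hf => mem_vanishingIdeal_iff.1 hf P hP) ?_
  rw [Ideal.span_singleton_le_iff_mem, RingHom.mem_ker, lineRestriction_of_isHomogeneous _ hh, hPh]
  simp

/-- The upper bound comes from the finitely many lines over `X`, the lower bound from the surjection
onto `K[X]` given by the line of a zero of `h`. -/
lemma krullDimension_linearSection (hX : X.Finite) (hh : h.IsHomogeneous 1)
    (hY : {P ∈ X | eval P.rep h = 0}.Nonempty) :
    krullDimension (vanishingIdeal X ⊔ Ideal.span {h}) = 1 := by
  obtain ⟨P, hP, hPh⟩ := hY
  have hle : Ring.KrullDimLE 1 (MvPolynomial V K ⧸ vanishingIdeal X ⊔ Ideal.span {h}) := by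
    refine krullDimLE_one_quotient hX.toFinset
      (fun P => (lineRestriction P.rep : MvPolynomial V K →+* Polynomial K))
      (fun Q _ => lineRestriction_surjective Q.rep_nonzero) ?_
    refine le_trans (fun f hf => mem_vanishingIdeal_iff.2 fun Q hQ => ?_) le_sup_left
    simp only [Submodule.mem_finsetInf] at hf
    exact hf Q (by simpa using hQ)
  have hge : 1 ≤ ringKrullDim (MvPolynomial V K ⧸ vanishingIdeal X ⊔ Ideal.span {h}) := by
    rw [← IsPrincipalIdealRing.ringKrullDim_eq_one (Polynomial K) (Polynomial.not_isField K)]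
    exact ringKrullDim_le_of_surjective
      (Ideal.Quotient.lift _ (lineRestriction P.rep : MvPolynomial V K →+* Polynomial K)
        (sup_span_le_ker_lineRestriction hh hP hPh))
      (Ideal.Quotient.lift_surjective_of_surjective _ _
        (lineRestriction_surjective P.rep_nonzero))
  have heq := le_antisymm (Ring.krullDimLE_iff.1 hle) hge
  rw [krullDimension, heq]
  rfl

lemma hilbertFunction_linearSection (hX : X.Finite) (hh : h.IsHomogeneous 1) {d : ℕ}
    (hd : X.ncard + 1 ≤ d) :
    hilbertFunction (vanishingIdeal X ⊔ Ideal.span {h}) d =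
      {P ∈ X | eval P.rep h = 0}.ncard := by
  classical
  set Y := {P ∈ X | eval P.rep h = 0} with hYdef
  have : Finite Y := (hX.subset (Set.sep_subset _ _)).to_subtype
  have := Fintype.ofFinite Y
  have hcard : hX.toFinset.card + 1 ≤ d := by
    rwa [← Set.ncard_eq_toFinset_card X hX]
  let ev : homogeneousSubmodule V K d →ₗ[K] (Y → K) :=
    LinearMap.pi fun P => (aeval (R := K) P.1.rep).toLinearMap ∘ₗ
      (homogeneousSubmodule V K d).subtype
  have hev : ∀ f P, ev f P = eval P.1.rep f.1 := fun f P => by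
    simp [ev]
  have hsurj : Function.Surjective ev := by
    intro a
    obtain ⟨f, hf, hfa⟩ := exists_isHomogeneous_eval_eq hX.toFinset
      (fun P => if hP : P ∈ Y then a ⟨P, hP⟩ else 0) (d := d) (by omega)
    refine ⟨⟨f, hf⟩, funext fun P => ?_⟩
    rw [hev, hfa P.1 (by simpa using P.2.1), dif_pos P.2]
  have hker : LinearMap.ker ev = ((vanishingIdeal X ⊔ Ideal.span {h}).restrictScalars K).comap
      (homogeneousSubmodule V K d).subtype := by
    ext f
    have hf : f.1.IsHomogeneous d := f.2
    rw [LinearMap.mem_ker, Submodule.mem_comap, Submodule.restrictScalars_mem,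
      Submodule.subtype_apply]
    constructor
    · intro h0
      -- Interpolate `f / h` one degree lower, so that `f - g * h` vanishes on `X`. At zeros of `h`
      -- the value of `g` is irrelevant, since `f` vanishes there too.
      obtain ⟨g, hg, hga⟩ := exists_isHomogeneous_eval_eq hX.toFinset
        (fun P => eval P.rep f.1 / eval P.rep h) (d := d - 1) (by omega)
      have hgh : (g * h).IsHomogeneous d := by
        convert hg.mul hh using 1
        omega
      have hmem : f.1 - g * h ∈ vanishingIdeal X := by
        rw [mem_vanishingIdeal_iff_of_isHomogeneous (hf.sub hgh)]
        intro P hP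
        rw [map_sub, map_mul, hga P (by simpa using hP)]
        by_cases hPh : eval P.rep h = 0
        · have := congrFun h0 ⟨P, hP, hPh⟩
          rw [hev] at this
          simp_all
        · rw [div_mul_cancel₀ _ hPh, sub_self]
      rw [← sub_add_cancel f.1 (g * h)]
      exact Ideal.add_mem _ (Ideal.mem_sup_left hmem)
        (Ideal.mem_sup_right (Ideal.mul_mem_left _ _ (Ideal.mem_span_singleton_self h)))
    · intro hmem
      refine funext fun P => ?_
      have := sup_span_le_ker_lineRestriction hh P.2.1 P.2.2 hmem
      rw [RingHom.mem_ker, lineRestriction_of_isHomogeneous _ hf] at this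
      rw [hev]
      simpa using this
  rw [hilbertFunction, ← hker, (ev.quotKerEquivOfSurjective hsurj).finrank_eq,
    Module.finrank_fintype_fun_eq_card, ← Nat.card_eq_fintype_card, Nat.card_coe_set_eq]

lemma degree_linearSection (hX : X.Finite) (hh : h.IsHomogeneous 1)
    (hY : {P ∈ X | eval P.rep h = 0}.Nonempty) :
    degree (vanishingIdeal X ⊔ Ideal.span {h}) =
      ({P ∈ X | eval P.rep h = 0}.ncard : ℝ) := by
  have hlim : Tendsto (fun d : ℕ =>
      (hilbertFunction (vanishingIdeal X ⊔ Ideal.span {h}) d : ℝ) / (d : ℝ) ^ (1 - 1)) atTop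
      (nhds ({P ∈ X | eval P.rep h = 0}.ncard : ℝ)) := by
    refine tendsto_const_nhds.congr' ?_
    filter_upwards [eventually_ge_atTop (X.ncard + 1)] with d hd
    simp [hilbertFunction_linearSection hX hh hd]
  rw [degree, krullDimension_linearSection hX hh hY, if_neg one_ne_zero, hlim.limUnder_eq]
  simp

lemma linearSectionDegrees_vanishingIdeal (hX : X.Finite) :
    linearSectionDegrees (vanishingIdeal X) =
      {M | ∃ h : MvPolynomial V K, h.IsHomogeneous 1 ∧ (∃ P ∈ X, eval P.rep h ≠ 0) ∧
        {P ∈ X | eval P.rep h = 0}.Nonempty ∧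
        M = ({P ∈ X | eval P.rep h = 0}.ncard : ℝ)} := by
  ext M
  refine exists_congr fun h => and_congr_right fun hh => ?_
  rw [colon_vanishingIdeal_ne_iff hX hh, mem_vanishingIdeal_iff_of_isHomogeneous hh]
  push Not
  refine and_congr_right fun _ => and_congr_right fun hY => ?_
  rw [degree_linearSection hX hh hY]

end Points
-- Codewords as values of linear forms
section Codewords

variable {V E K : Type*} [Field K]

lemma mem_rowCode_iff [Fintype V] {A : Matrix V E K} {x : E → K} :
    x ∈ rowCode A ↔ ∃ h : MvPolynomial V K, h.IsHomogeneous 1 ∧ ∀ e, x e = eval (A.col e) h := by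
  classical
  rw [rowCode, Submodule.mem_span_range_iff_exists_fun]
  constructor
  · rintro ⟨c, rfl⟩
    refine ⟨∑ v, C (c v) * MvPolynomial.X v, IsHomogeneous.sum _ _ _ fun v _ =>
      isHomogeneous_C_mul_X _ _, fun e => ?_⟩
    simp [Matrix.row, Matrix.col]
  · rintro ⟨h, hh, hx⟩
    refine ⟨fun v => coeff (Finsupp.single v 1) h, funext fun e => ?_⟩
    have hsub : h.support ⊆ Finset.univ.image fun v : V => Finsupp.single v 1 := by
      intro m hm
      obtain ⟨v, rfl⟩ := (Finsupp.sum_eq_one_iff m).1 (hh.degree_eq_sum_deg_support hm).symm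
      simp
    rw [hx e, eval_eq', Finset.sum_subset hsub (fun m _ hm => by simp [notMem_support_iff.1 hm]),
      Finset.sum_image fun a _ b _ hab => Finsupp.single_left_injective one_ne_zero hab,
      Finset.sum_apply]
    refine Finset.sum_congr rfl fun v _ => ?_
    rw [Finset.prod_eq_single v (fun b _ hb => by simp [hb.symm]) (by simp)]
    simp [Matrix.row, Matrix.col]

lemma eval_smul_of_isHomogeneous {f : MvPolynomial V K} {d : ℕ} (hf : f.IsHomogeneous d)
    (a : K) (v : V → K) : eval (a • v) f = a ^ d * eval v f := by
  simp only [eval_eq, Finset.mul_sum]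
  refine Finset.sum_congr rfl fun m hm => ?_
  simp only [Pi.smul_apply, smul_eq_mul, mul_pow, Finset.prod_mul_distrib]
  rw [Finset.prod_pow_eq_pow_sum, ← hf.degree_eq_sum_deg_support hm]
  ring

lemma eval_mk_rep_eq_zero_iff {v : V → K} (hv : v ≠ 0) {f : MvPolynomial V K} {d : ℕ}
    (hf : f.IsHomogeneous d) :
    eval (Projectivization.mk K v hv).rep f = 0 ↔ eval v f = 0 := by
  obtain ⟨a, ha⟩ := Projectivization.exists_smul_eq_mk_rep K v hv
  rw [← ha, Units.smul_def, eval_smul_of_isHomogeneous hf]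
  simp

section Columns

variable {A : Matrix V E K} (hA : ∀ e, A.col e ≠ 0)
  (hinj : Function.Injective fun e => Projectivization.mk K (A.col e) (hA e))

include hA in
lemma columnPoints_eq_range :
    columnPoints A = Set.range fun e => Projectivization.mk K (A.col e) (hA e) := by
  ext P
  exact ⟨fun ⟨e, _, h⟩ => ⟨e, h.symm⟩, fun ⟨e, h⟩ => ⟨e, hA e, h.symm⟩⟩

include hinj in
lemma ncard_columnPoints [Fintype E] : (columnPoints A).ncard = Fintype.card E := by
  rw [columnPoints_eq_range hA, ← Set.image_univ, Set.ncard_image_of_injective _ hinj,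
    Set.ncard_univ, Nat.card_eq_fintype_card]

include hinj in
/-- The weight of the codeword of a linear form is the number of column points at which the form
does not vanish. -/
lemma hammingNorm_add_ncard_zeros [Fintype E] [DecidableEq K] {h : MvPolynomial V K}
    (hh : h.IsHomogeneous 1) {x : E → K} (hx : ∀ e, x e = eval (A.col e) h) :
    hammingNorm x + {P ∈ columnPoints A | eval P.rep h = 0}.ncard = (columnPoints A).ncard := by
  classical
  have hY : {P ∈ columnPoints A | eval P.rep h = 0} =
      (fun e => Projectivization.mk K (A.col e) (hA e)) '' {e | x e = 0} := by
    rw [columnPoints_eq_range hA]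
    ext P
    constructor
    · rintro ⟨⟨e, rfl⟩, he⟩
      exact ⟨e, (hx e).trans ((eval_mk_rep_eq_zero_iff (hA e) hh).1 he), rfl⟩
    · rintro ⟨e, he, rfl⟩
      exact ⟨⟨e, rfl⟩, (eval_mk_rep_eq_zero_iff (hA e) hh).2 ((hx e).symm.trans he)⟩
  rw [hY, Set.ncard_image_of_injective _ hinj, ncard_columnPoints hA hinj,
    Set.ncard_eq_toFinset_card', Set.toFinset_ofPred, hammingNorm, add_comm]
  exact Finset.card_filter_add_card_filter_not _

include hA in
lemma exists_columnPoint_eval_ne_zero_iff {h : MvPolynomial V K}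
    (hh : h.IsHomogeneous 1) {x : E → K} (hx : ∀ e, x e = eval (A.col e) h) :
    (∃ P ∈ columnPoints A, eval P.rep h ≠ 0) ↔ x ≠ 0 := by
  rw [columnPoints_eq_range hA, Set.exists_range_iff, Function.ne_iff]
  refine exists_congr fun e => ?_
  rw [Ne, eval_mk_rep_eq_zero_iff (hA e) hh, hx e]
  rfl

lemma exists_hammingNorm_eq_minDist [Fintype E] [DecidableEq K] {C : Submodule K (E → K)}
    (hC : C ≠ ⊥) : ∃ x ∈ C, x ≠ 0 ∧ hammingNorm x = minDist C := by
  obtain ⟨x, hx, hx0⟩ := C.ne_bot_iff.1 hC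
  exact Nat.sInf_mem (s := {w | ∃ x ∈ C, x ≠ 0 ∧ hammingNorm x = w}) ⟨_, x, hx, hx0, rfl⟩

lemma minDist_le [Fintype E] [DecidableEq K] {C : Submodule K (E → K)} {x : E → K} (hx : x ∈ C)
    (hx0 : x ≠ 0) : minDist C ≤ hammingNorm x :=
  Nat.sInf_le ⟨x, hx, hx0, rfl⟩

include hinj in
/-- The minimum distance in terms of the degrees of linear sections of the column points, when
some linear form vanishes at some of these points but not at all of them. -/
lemma exists_isGreatest_minDist_eq [Fintype V] [Fintype E] [DecidableEq K]
    {h : MvPolynomial V K} (hh : h.IsHomogeneous 1)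
    (h0 : ∃ e, eval (A.col e) h = 0) (h1 : ∃ e, eval (A.col e) h ≠ 0) :
    ∃ M : ℝ, IsGreatest (linearSectionDegrees (vanishingIdeal (columnPoints A))) M ∧
      (minDist (rowCode A) : ℝ) = ((columnPoints A).ncard : ℝ) - M := by
  have hX : (columnPoints A).Finite := by
    rw [columnPoints_eq_range hA]
    exact Set.finite_range _
  have hyC : (fun e => eval (A.col e) h) ∈ rowCode A := mem_rowCode_iff.2 ⟨h, hh, fun _ => rfl⟩
  have hy0 : (fun e => eval (A.col e) h) ≠ 0 := Function.ne_iff.2 h1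
  have hC : rowCode A ≠ ⊥ := (Submodule.ne_bot_iff _).2 ⟨_, hyC, hy0⟩
  obtain ⟨x, hx, hx0, hmin⟩ := exists_hammingNorm_eq_minDist hC
  obtain ⟨g, hg, hxg⟩ := mem_rowCode_iff.1 hx
  have hwt := hammingNorm_add_ncard_zeros hA hinj hg hxg
  rw [linearSectionDegrees_vanishingIdeal hX]
  refine ⟨_, ⟨⟨g, hg, (exists_columnPoint_eval_ne_zero_iff hA hg hxg).2 hx0, ?_, rfl⟩, ?_⟩, ?_⟩
  -- A word of minimum weight has a zero entry, because the nonzero word of `h` already has one.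
  · have hwt' := hammingNorm_add_ncard_zeros hA hinj hh fun _ => rfl
    have hle := minDist_le hyC hy0
    have hpos : 0 < {P ∈ columnPoints A | eval P.rep h = 0}.ncard := by
      rw [Set.ncard_pos (hX.subset (Set.sep_subset _ _)), columnPoints_eq_range hA]
      obtain ⟨e, he⟩ := h0
      exact ⟨_, ⟨e, rfl⟩, (eval_mk_rep_eq_zero_iff (hA e) hh).2 he⟩
    rw [← Set.ncard_pos (hX.subset (Set.sep_subset _ _))]
    omega
  · rintro _ ⟨f, hf, hf1, -, rfl⟩
    have hwt' := hammingNorm_add_ncard_zeros hA hinj hf fun _ => rfl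
    have hle := minDist_le (mem_rowCode_iff.2 ⟨f, hf, fun _ => rfl⟩)
      ((exists_columnPoint_eval_ne_zero_iff hA hf fun _ => rfl).1 hf1)
    exact_mod_cast (by omega)
  · rw [← hmin, ← hwt]
    push_cast
    ring

end Columns

end Codewords

/-! ### Incidence matrices of signed graphs -/

section Graph

variable {V : Type*} [DecidableEq V] {G : SimpleGraph V} (K : Type*) [Field K]
  (σ : G.edgeSet → ℤˣ) (o : EdgeOrdering G)

/-- The ends of an edge are distinct, so the entries `1` and `±1` never share a row and stay nonzero
in every characteristic. -/
lemma incidenceMatrix_ne_zero_iff (v : V) (e : G.edgeSet) :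
    incidenceMatrix K σ o v e ≠ 0 ↔ v ∈ (e : Sym2 V) := by
  have he := (o e).2
  have hne : (o e).1.1 ≠ (o e).1.2 := by
    have := e.2
    rw [← he, SimpleGraph.mem_edgeSet] at this
    exact this.ne
  rw [← he, Sym2.mem_iff]
  have hσ : (((σ e : ℤˣ) : ℤ) : K) ≠ 0 := by
    rcases Int.units_eq_one_or (σ e) with h | h <;> simp [h]
  by_cases h1 : v = (o e).1.1
  · subst h1
    simp [incidenceMatrix, hne]
  · by_cases h2 : v = (o e).1.2
    · subst h2
      simp [incidenceMatrix, h1, hσ]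
    · simp [incidenceMatrix, h1, h2]

lemma col_incidenceMatrix_ne_zero (e : G.edgeSet) : (incidenceMatrix K σ o).col e ≠ 0 :=
  Function.ne_iff.2 ⟨(e : Sym2 V).out.1,
    (incidenceMatrix_ne_zero_iff K σ o _ e).2 (Sym2.out_fst_mem _)⟩

lemma mk_col_incidenceMatrix_injective : Function.Injective fun e =>
    Projectivization.mk K ((incidenceMatrix K σ o).col e)
      (col_incidenceMatrix_ne_zero K σ o e) := by
  have key : ∀ e f, Projectivization.mk K ((incidenceMatrix K σ o).col e)
      (col_incidenceMatrix_ne_zero K σ o e) = Projectivization.mk K ((incidenceMatrix K σ o).col f)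
      (col_incidenceMatrix_ne_zero K σ o f) → ∀ v ∈ (e : Sym2 V), v ∈ (f : Sym2 V) := by
    intro e f hef v hv
    obtain ⟨a, ha⟩ := (Projectivization.mk_eq_mk_iff' K _ _ _ _).1 hef
    rw [← incidenceMatrix_ne_zero_iff K σ o] at hv ⊢
    exact fun h0 => hv ((congrFun ha v).symm.trans (by simp [Matrix.col, h0]))
  exact fun e f hef => Subtype.ext (Sym2.ext fun v => ⟨key e f hef v, key f e hef.symm v⟩)

omit [DecidableEq V] in
lemma exists_edge_mem [Nontrivial V] (hG : G.Connected) (v : V) :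
    ∃ e : G.edgeSet, v ∈ (e : Sym2 V) := by
  obtain ⟨w, hw⟩ := hG.preconnected.exists_adj_of_nontrivial v
  exact ⟨⟨s(v, w), hw⟩, Sym2.mem_mk_left v w⟩

lemma subsingleton_edgeSet_of_card_eq_two [Fintype V] (hV : Fintype.card V = 2) :
    Subsingleton G.edgeSet := by
  have key : ∀ (e : G.edgeSet) (v : V), v ∈ (e : Sym2 V) := by
    rintro ⟨e, he⟩ v
    induction e with | _ a b =>
    have hab : ({a, b} : Finset V) = Finset.univ := by
      rw [← Finset.card_eq_iff_eq_univ, hV, Finset.card_pair (SimpleGraph.Adj.ne he)]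
    simpa [← hab] using Finset.mem_univ v
  exact ⟨fun e f => Subtype.ext (Sym2.ext fun v => by simp [key])⟩

lemma rowCode_incidenceMatrix_ne_bot (e : G.edgeSet) :
    rowCode (incidenceMatrix K σ o) ≠ ⊥ := by
  refine (Submodule.ne_bot_iff _).2
    ⟨_, Submodule.subset_span ⟨(e : Sym2 V).out.1, rfl⟩, Function.ne_iff.2 ⟨e, ?_⟩⟩
  exact (incidenceMatrix_ne_zero_iff K σ o _ e).2 (Sym2.out_fst_mem _)

end Graph

end SignedGraphCode

theorem mainTheorem7 {V : Type*} [Fintype V] [DecidableEq V] (G : SimpleGraph V)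
    [Fintype G.edgeSet] (hG : G.Connected) (hV : 2 ≤ Fintype.card V)
    (σ : G.edgeSet → ℤˣ) (o : SignedGraphCode.EdgeOrdering G)
    (K : Type*) [Field K] [Finite K] [DecidableEq K] :
    let A := SignedGraphCode.incidenceMatrix K σ o
    let C := SignedGraphCode.rowCode A
    let X := SignedGraphCode.columnPoints A
    let D := SignedGraphCode.linearSectionDegrees (SignedGraphCode.vanishingIdeal X)
    C ≠ ⊥ ∧
    (3 ≤ Fintype.card V →
      ∃ M : ℝ, IsGreatest D M ∧ (SignedGraphCode.minDist C : ℝ) = (X.ncard : ℝ) - M) ∧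
    (Fintype.card V = 2 → D = ∅ ∧ SignedGraphCode.minDist C = X.ncard) := by
  intro A C X D
  have : Nontrivial V := Fintype.one_lt_card_iff_nontrivial.1 hV
  have hA := SignedGraphCode.col_incidenceMatrix_ne_zero K σ o
  have hinj := SignedGraphCode.mk_col_incidenceMatrix_injective K σ o
  obtain ⟨e, -⟩ := SignedGraphCode.exists_edge_mem hG (Classical.arbitrary V)
  have hC : C ≠ ⊥ := SignedGraphCode.rowCode_incidenceMatrix_ne_bot K σ o e
  refine ⟨hC, fun h3 => ?_, fun h2 => ?_⟩
  -- The variable of a vertex `c` off `e` vanishes at the column of `e` but not at that of an edge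
  -- through `c`, which connectedness provides.
  · obtain ⟨c, hc⟩ : ∃ c, c ∉ (e : Sym2 V) := by
      by_contra! hall
      have hcard := Finset.card_le_card (s := Finset.univ) (t := (e : Sym2 V).toFinset)
        fun v _ => Sym2.mem_toFinset.2 (hall v)
      rw [Finset.card_univ, Sym2.card_toFinset] at hcard
      split_ifs at hcard <;> omega
    obtain ⟨f, hf⟩ := SignedGraphCode.exists_edge_mem hG c
    refine SignedGraphCode.exists_isGreatest_minDist_eq hA hinj (h := MvPolynomial.X c)
      (MvPolynomial.isHomogeneous_X K c) ⟨e, ?_⟩ ⟨f, ?_⟩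
    · rw [eval_X]
      exact not_not.1 (mt (SignedGraphCode.incidenceMatrix_ne_zero_iff K σ o c e).1 hc)
    · rw [eval_X]
      exact (SignedGraphCode.incidenceMatrix_ne_zero_iff K σ o c f).2 hf
  -- With a single point, a form nonzero somewhere on `X` has no zero on `X`, so every nonzero word
  -- has full weight.
  · have := SignedGraphCode.subsingleton_edgeSet_of_card_eq_two (G := G) h2
    have hXr := SignedGraphCode.columnPoints_eq_range hA
    have hXf : X.Finite := by
      rw [show X = _ from hXr]
      exact Set.finite_range _
    have hXs : X.Subsingleton := by
      rw [show X = _ from hXr]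
      exact Set.subsingleton_range _
    have hempty : ∀ h : MvPolynomial V K, (∃ P ∈ X, eval P.rep h ≠ 0) →
        ¬ {P ∈ X | eval P.rep h = 0}.Nonempty := by
      rintro h ⟨P, hP, hPh⟩ ⟨Q, hQ, hQh⟩
      exact hPh (hXs hP hQ ▸ hQh)
    refine ⟨?_, ?_⟩
    · rw [show D = _ from SignedGraphCode.linearSectionDegrees_vanishingIdeal hXf]
      exact Set.eq_empty_of_forall_notMem fun _ ⟨h, _, hne, hY, _⟩ => hempty h hne hY
    · obtain ⟨x, hx, hx0, hmin⟩ := SignedGraphCode.exists_hammingNorm_eq_minDist hC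
      obtain ⟨g, hg, hxg⟩ := SignedGraphCode.mem_rowCode_iff.1 hx
      have hwt := SignedGraphCode.hammingNorm_add_ncard_zeros hA hinj hg hxg
      have hY := hempty g
        ((SignedGraphCode.exists_columnPoint_eval_ne_zero_iff hA hg hxg).2 hx0)
      rw [Set.not_nonempty_iff_eq_empty.1 hY, Set.ncard_empty, add_zero] at hwt
      rw [← hmin, hwt]
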